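/- For every integer $r\ge 1$ there is a constant $C_r>0$, depending only on $r$, such that the following holds. Let $d,n\ge 1$ be integers, let $a$ be a random vector in $\mathbb{R}^d$, and let $a_1,\dots,a_n$ be i.i.d. copies of $a$. Write $\mathcal{B}(0,1)$ for the closed Euclidean unit ball of $\mathbb{R}^d$. Assume that $a$ is sub-Gaussian with parameter $\rho>0$, that is, $$\mathbb{P}\bigl(|a^\top x|\ge \rho\,\epsilon\bigr)\le 2\,e^{-\epsilon^2/(2\|x\|^2)}\qquad\text{for all } \epsilon>0 \text{ and all nonzero } x\in\mathcal{B}(0,1).$$ Let $\varphi_1,\dots,\varphi_r:\mathbb{R}\to\mathbb{R}$ be $1$-Lipschitz functions with $\varphi_k(0)=0$, let $B_1,\dots,B_r$ be real numbers such that, for each $k$, almost surely $\sup_{x\in\mathcal{B}(0,1)}|\varphi_k(a^\top x)|\le B_k$, and put $B=\prod_{k=1}^r B_k$. Then for all $\gamma>0$, $$\mathbb{P}\left(\sup_{x_1,\ldots,x_r\in\mathcal{B}(0,1)}\frac1n\sum_{i=1}^n\left\{\prod_{k=1}^r\varphi_k(a_i^\top x_k)-\mathbb{E}\prod_{k=1}^r\varphi_k(a^\top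 x_k)\right\}\ \ge\ \rho^r C_r\,(d+\gamma)\left[\frac{1}{\sqrt{dn}}+\frac{(\rho^{-r}B)^{1-2/r}}{n}\right]\right)\ \le\ r\,\frac{\pi^2}{6}\,e^{-\gamma}.$$ (If $r=1$ and $B=0$, the term $(\rho^{-r}B)^{1-2/r}$ is read as $0$.) -/

import Mathlib

open MeasureTheory ProbabilityTheory

/-- The random vector `a` is sub-Gaussian with parameter `ρ`:
`ℙ(|aᵀx| ≥ ρ ε) ≤ 2 exp(-ε² / (2‖x‖²))` for all `ε > 0` and all `x` in the closed unit ball.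
(The condition is invariant under `(x, ε) ↦ (c x, c ε)`, so the radius of the ball is immaterial;
at `x = 0` it is void.) -/
def IsSubGaussianVector {d : ℕ} {Ω : Type*} [MeasurableSpace Ω] (P : Measure Ω) (ρ : ℝ)
    (a : Ω → EuclideanSpace ℝ (Fin d)) : Prop :=
  ∀ ε : ℝ, 0 < ε → ∀ x ∈ Metric.closedBall (0 : EuclideanSpace ℝ (Fin d)) 1,
    P.real {ω | ρ * ε ≤ |inner ℝ (a ω) x|} ≤ 2 * Real.exp (-(ε ^ 2 / (2 * ‖x‖ ^ 2)))

/-- `sup_{x₁,…,x_r ∈ 𝓑(0,1)} (1/n) ∑ᵢ { ∏ₖ φₖ(aᵢᵀxₖ) - 𝔼 ∏ₖ φₖ(aᵀxₖ) }`, as a function of the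
outcome `ω`; `A i` is the sample `aᵢ` and `a` the generic vector. -/
noncomputable def supDeviation {r d n : ℕ} {Ω : Type*} [MeasurableSpace Ω] (P : Measure Ω)
    (φ : Fin r → ℝ → ℝ) (a : Ω → EuclideanSpace ℝ (Fin d))
    (A : Fin n → Ω → EuclideanSpace ℝ (Fin d)) (ω : Ω) : ℝ :=
  ⨆ x : Fin r → Metric.closedBall (0 : EuclideanSpace ℝ (Fin d)) 1,
    (1 / (n : ℝ)) * ∑ i : Fin n,
      (∏ k : Fin r, φ k (inner ℝ (A i ω) (x k : EuclideanSpace ℝ (Fin d)))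
        - ∫ ω', ∏ k : Fin r, φ k (inner ℝ (a ω') (x k : EuclideanSpace ℝ (Fin d))) ∂P)

/-! The proof is a chaining argument. Scaling reduces to ρ = 1. For tuples `x`, `y` at distance `δ`,
the increment of the product is at most `r δ √H ^ r`, where `H` is a sum of squares of `3r`
sub-Gaussian marginals and has a bounded exponential moment.

When r ≥ 2, write an increment `w` as `w ^ (1 - 2/r) * w ^ (2/r)`. The almost sure bound controls
the first factor, and the second is linear in `H`. So `μ w` stays below a small multiple of `H`
while `μ δ ^ (2/r) K` is small, with `K` equal to the product of the bounds to the power `1 - 2/r`.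
In that range the centred increment has a Gaussian moment generating function (`mgf_increment_le`).
When r = 1, completing a square does the same for every `μ ≥ 0`.

Chernoff's bound then gives a tail for each increment of the empirical mean
(`deviation_increment_tail`). At level `l` there are at most `5 ^ (2rd(l+1))` pairs of net points. A
threshold proportional to `(l+1)(d+γ)` beats this count and leaves failure probability `exp(-γ) 2 ^
(-(l+1))`. The thresholds are summable in `l`, and chains start at `0`, where the process vanishes.

This yields the bound `exp(-γ)`, stronger than required since `r π² / 6 ≥ 1`. -/

lemma abs_prod_sub_prod_le {ι : Type*} (s : Finset ι) (p q : ι → ℝ) {m δ : ℝ} (hm : 0 ≤ m)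
    (hδ : 0 ≤ δ) (hp : ∀ k, |p k| ≤ m) (hq : ∀ k, |q k| ≤ m) (hpq : ∀ k, |p k - q k| ≤ δ * m) :
    |∏ k ∈ s, p k - ∏ k ∈ s, q k| ≤ s.card * δ * m ^ s.card := by
  classical
  induction s using Finset.induction_on with
  | empty => simp
  | insert i s hi ih =>
    rw [Finset.prod_insert hi, Finset.prod_insert hi, Finset.card_insert_of_notMem hi]
    have hs : |∏ k ∈ s, q k| ≤ m ^ s.card := by
      rw [Finset.abs_prod]
      exact (Finset.prod_le_prod (fun _ _ => abs_nonneg _) fun k _ => hq k).trans_eq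
        (Finset.prod_const m)
    calc |p i * ∏ k ∈ s, p k - q i * ∏ k ∈ s, q k|
        = |p i * (∏ k ∈ s, p k - ∏ k ∈ s, q k) + (p i - q i) * ∏ k ∈ s, q k| := by
          congr 1; ring
      _ ≤ |p i| * |∏ k ∈ s, p k - ∏ k ∈ s, q k| + |p i - q i| * |∏ k ∈ s, q k| := by
          rw [← abs_mul, ← abs_mul]; exact abs_add_le _ _
      _ ≤ m * (s.card * δ * m ^ s.card) + δ * m * m ^ s.card := by
          gcongr
          · exact hp i
          · exact hpq i
      _ = ((s.card + 1 : ℕ) : ℝ) * δ * m ^ (s.card + 1) := by push_cast; ring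

lemma exp_le_one_add_add_sq_mul_exp_abs (u : ℝ) :
    Real.exp u ≤ 1 + u + u ^ 2 * Real.exp |u| := by
  have h1 : Real.exp u - 1 ≤ u * Real.exp u := by
    have h := mul_le_mul_of_nonneg_right (Real.add_one_le_exp (-u)) (Real.exp_pos u).le
    rw [← Real.exp_add, neg_add_cancel, Real.exp_zero] at h
    linarith
  rcases le_total 0 u with h | h
  · rw [abs_of_nonneg h]
    nlinarith [mul_le_mul_of_nonneg_left h1 h]
  · have h2 : u * Real.exp u - u ≤ u ^ 2 := by nlinarith [Real.add_one_le_exp u]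
    have h3 : u ^ 2 * 1 ≤ u ^ 2 * Real.exp |u| :=
      mul_le_mul_of_nonneg_left (Real.one_le_exp (abs_nonneg u)) (sq_nonneg u)
    linarith

lemma pow_le_factorial_div_mul_exp {c x : ℝ} (hc : 0 < c) (hx : 0 ≤ x) (r : ℕ) :
    x ^ r ≤ r.factorial / c ^ r * Real.exp (c * x) := by
  have h := Real.pow_div_factorial_le_exp (c * x) (mul_nonneg hc.le hx) r
  rw [div_le_iff₀ (by positivity), mul_pow] at h
  rw [div_mul_eq_mul_div, le_div_iff₀ (by positivity)]
  linarith

/-! ### Exponential moments of sub-Gaussian variables and of their polynomials -/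

section

variable {Ω : Type*} [MeasurableSpace Ω] {P : Measure Ω} [IsProbabilityMeasure P]

/-- Layer-cake formula: levels `t ≤ 1` contribute at most 1, and for `t > 1` the choice `ε = √(4 log
t)` turns the tail into `2 t⁻²`, of integral 2. -/
lemma lintegral_exp_sq_div_four_le {g : Ω → ℝ} (hg : Measurable g)
    (h : ∀ ε : ℝ, 0 < ε → P.real {ω | ε ≤ |g ω|} ≤ 2 * Real.exp (-(ε ^ 2 / 2))) :
    ∫⁻ ω, ENNReal.ofReal (Real.exp (g ω ^ 2 / 4)) ∂P ≤ 3 := by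
  rw [lintegral_eq_lintegral_meas_le P (Filter.Eventually.of_forall fun ω => (Real.exp_pos _).le)
    (by fun_prop)]
  rw [← Set.Ioc_union_Ioi_eq_Ioi (zero_le_one (α := ℝ)),
    lintegral_union measurableSet_Ioi Set.Ioc_disjoint_Ioi_same]
  have h1 : ∫⁻ t in Set.Ioc (0 : ℝ) 1, P {ω | t ≤ Real.exp (g ω ^ 2 / 4)} ≤ 1 := by
    calc _ ≤ ∫⁻ _ in Set.Ioc (0 : ℝ) 1, 1 := lintegral_mono fun t => prob_le_one
      _ = 1 := by simp
  have h2 : ∫⁻ t in Set.Ioi (1 : ℝ), P {ω | t ≤ Real.exp (g ω ^ 2 / 4)} ≤ 2 := by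
    calc _ ≤ ∫⁻ t in Set.Ioi (1 : ℝ), ENNReal.ofReal (2 * t ^ (-2 : ℝ)) := by
          refine setLIntegral_mono' measurableSet_Ioi fun t (ht : 1 < t) => ?_
          have hl : 0 < Real.log t := Real.log_pos ht
          rw [← ofReal_measureReal]
          refine ENNReal.ofReal_le_ofReal ?_
          have hε : 0 < √(4 * Real.log t) := by positivity
          refine (measureReal_mono (fun ω (hω : t ≤ _) => ?_)).trans ((h _ hε).trans_eq ?_)
          · rw [← Real.log_le_iff_le_exp (by linarith)] at hω
            exact Real.sqrt_le_iff.mpr ⟨abs_nonneg _, by rw [sq_abs]; linarith⟩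
          · rw [Real.sq_sqrt (by positivity), Real.rpow_def_of_pos (by linarith)]
            ring_nf
      _ = ENNReal.ofReal (∫ t in Set.Ioi (1 : ℝ), 2 * t ^ (-2 : ℝ)) := by
          rw [ofReal_integral_eq_lintegral_ofReal]
          · exact (integrableOn_Ioi_rpow_of_lt (by norm_num) one_pos).const_mul _
          · refine ae_restrict_of_forall_mem measurableSet_Ioi fun t (ht : 1 < t) => ?_
            have : 0 < t := by linarith
            positivity
      _ = 2 := by
          rw [integral_const_mul, integral_Ioi_rpow_of_lt (by norm_num) one_pos]
          norm_num
  calc _ ≤ (1 : ENNReal) + 2 := add_le_add h1 h2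
    _ = 3 := by norm_num

lemma integrable_exp_sq_div_four {g : Ω → ℝ} (hg : Measurable g)
    (h : ∀ ε : ℝ, 0 < ε → P.real {ω | ε ≤ |g ω|} ≤ 2 * Real.exp (-(ε ^ 2 / 2))) :
    Integrable (fun ω => Real.exp (g ω ^ 2 / 4)) P ∧ ∫ ω, Real.exp (g ω ^ 2 / 4) ∂P ≤ 3 := by
  have h3 := lintegral_exp_sq_div_four_le hg h
  have h0 : 0 ≤ᵐ[P] fun ω => Real.exp (g ω ^ 2 / 4) :=
    Filter.Eventually.of_forall fun ω => (Real.exp_pos _).le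
  have hm : AEStronglyMeasurable (fun ω => Real.exp (g ω ^ 2 / 4)) P := by fun_prop
  refine ⟨⟨hm, ?_⟩, ?_⟩
  · rw [hasFiniteIntegral_iff_ofReal h0]
    exact h3.trans_lt (by norm_num)
  · rw [integral_eq_lintegral_of_nonneg_ae h0 hm]
    exact ENNReal.toReal_le_of_le_ofReal (by norm_num) (h3.trans_eq (by norm_num))

/-- Jensen's inequality for `exp` reduces the mean of squares to single variables, so no
independence between them is needed. -/
lemma integrable_exp_mean_sq {ι : Type*} [Fintype ι] [Nonempty ι] {g : ι → Ω → ℝ}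
    (hg : ∀ i, Measurable (g i))
    (h : ∀ i, ∀ ε : ℝ, 0 < ε → P.real {ω | ε ≤ |g i ω|} ≤ 2 * Real.exp (-(ε ^ 2 / 2))) :
    Integrable (fun ω => Real.exp ((∑ i, g i ω ^ 2) / (4 * Fintype.card ι))) P ∧
      ∫ ω, Real.exp ((∑ i, g i ω ^ 2) / (4 * Fintype.card ι)) ∂P ≤ 3 := by
  have hN : (0 : ℝ) < Fintype.card ι := by exact_mod_cast Fintype.card_pos
  have hJ : ∀ ω, Real.exp ((∑ i, g i ω ^ 2) / (4 * Fintype.card ι))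
      ≤ ∑ i, (Fintype.card ι : ℝ)⁻¹ * Real.exp (g i ω ^ 2 / 4) := by
    intro ω
    have := convexOn_exp.map_sum_le (t := Finset.univ) (w := fun _ : ι => (Fintype.card ι : ℝ)⁻¹)
      (p := fun i => g i ω ^ 2 / 4) (fun _ _ => by positivity) (by simp [hN.ne']) (by simp)
    simp only [smul_eq_mul] at this
    refine (congrArg Real.exp ?_).trans_le this
    rw [← Finset.mul_sum, ← Finset.sum_div]
    field_simp
  have hi : Integrable (fun ω => ∑ i, (Fintype.card ι : ℝ)⁻¹ * Real.exp (g i ω ^ 2 / 4)) P :=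
    integrable_finsetSum _ fun i _ => (integrable_exp_sq_div_four (hg i) (h i)).1.const_mul _
  have hI : Integrable (fun ω => Real.exp ((∑ i, g i ω ^ 2) / (4 * Fintype.card ι))) P :=
    hi.mono' (by fun_prop) (Filter.Eventually.of_forall fun ω => by
      rw [Real.norm_of_nonneg (Real.exp_pos _).le]; exact hJ ω)
  refine ⟨hI, (integral_mono hI hi hJ).trans ?_⟩
  rw [integral_finsetSum _ fun i _ => (integrable_exp_sq_div_four (hg i) (h i)).1.const_mul _]
  simp_rw [integral_const_mul]
  calc _ ≤ ∑ _i : ι, (Fintype.card ι : ℝ)⁻¹ * 3 := by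
        gcongr with i
        exact (integrable_exp_sq_div_four (hg i) (h i)).2
    _ = 3 := by simp

/-- A random variable `W` of size `δ` dominated by the `r`-th power of a sub-Gaussian envelope `√H`
has a Gaussian moment generating function as long as `μ |W|` is controlled by `H`. -/
lemma mgf_sub_integral_le {W H : Ω → ℝ} (hW : Measurable W) (hH0 : ∀ ω, 0 ≤ H ω) {c δ μ D : ℝ} {r : ℕ} (hc : 0 < c) (hD : 0 ≤ D)
    (hint : Integrable (fun ω => Real.exp (2 * c * H ω)) P)
    (hle : ∫ ω, Real.exp (2 * c * H ω) ∂P ≤ 3)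
    (hsq : ∀ ω, W ω ^ 2 ≤ δ ^ 2 * r ^ 2 * H ω ^ r) (hμ : 0 ≤ μ)
    (habs : ∀ᵐ ω ∂P, μ * |W ω| ≤ D * (μ ^ 2 * δ ^ 2) + c * H ω) :
    Integrable (fun ω => Real.exp (μ * (W ω - ∫ ω', W ω' ∂P))) P ∧
    mgf (fun ω => W ω - ∫ ω', W ω' ∂P) P μ
      ≤ Real.exp ((4 * (3 * r ^ 2 * (r.factorial / c ^ r)) + D) * (μ ^ 2 * δ ^ 2)) := by
  set x : ℝ := μ ^ 2 * δ ^ 2 with hx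
  set q : ℝ := r ^ 2 * (r.factorial / c ^ r) with hq
  have hq0 : 0 ≤ q := by positivity
  have hx0 : 0 ≤ x := by positivity
  have hW2 : ∀ ω, W ω ^ 2 ≤ δ ^ 2 * q * Real.exp (c * H ω) := fun ω => by
    refine (hsq ω).trans ?_
    have := mul_le_mul_of_nonneg_left (pow_le_factorial_div_mul_exp hc (hH0 ω) r)
      (by positivity : 0 ≤ δ ^ 2 * (r : ℝ) ^ 2)
    refine this.trans_eq ?_
    rw [hq]; ring
  have hexp : ∀ ω, Real.exp (c * H ω) ≤ Real.exp (2 * c * H ω) := fun ω => by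
    gcongr
    · exact hH0 ω
    · linarith
  have hW2' : ∀ ω, W ω ^ 2 ≤ δ ^ 2 * q * Real.exp (2 * c * H ω) := fun ω =>
    (hW2 ω).trans (mul_le_mul_of_nonneg_left (hexp ω) (by positivity))
  have hiW2 : Integrable (fun ω => W ω ^ 2) P :=
    (hint.const_mul (δ ^ 2 * q)).mono' (by fun_prop) (Filter.Eventually.of_forall fun ω => by
      rw [Real.norm_of_nonneg (sq_nonneg _)]; exact hW2' ω)
  have hmem : MemLp W 2 P := (memLp_two_iff_integrable_sq hW.aestronglyMeasurable).2 hiW2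
  have hiW : Integrable W P := hmem.integrable (by norm_num)
  have hEW : (∫ ω, W ω ∂P) ^ 2 ≤ δ ^ 2 * (3 * q) := by
    have h1 := variance_nonneg W P
    rw [variance_eq_sub hmem] at h1
    have h2 : ∫ ω, W ω ^ 2 ∂P ≤ δ ^ 2 * q * 3 := by
      refine (integral_mono hiW2 (hint.const_mul _) hW2').trans ?_
      rw [integral_const_mul]
      gcongr
    simp only [Pi.pow_apply] at h1
    linarith
  set v : ℝ := μ * ∫ ω, W ω ∂P with hv
  have hpt : ∀ᵐ ω ∂P, Real.exp (μ * W ω)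
      ≤ 1 + μ * W ω + x * q * Real.exp (D * x) * Real.exp (2 * c * H ω) := by
    filter_upwards [habs] with ω hω
    refine (exp_le_one_add_add_sq_mul_exp_abs _).trans ?_
    rw [abs_mul, abs_of_nonneg hμ]
    have h1 : (μ * W ω) ^ 2 ≤ x * q * Real.exp (c * H ω) := by
      have := mul_le_mul_of_nonneg_left (hW2 ω) (sq_nonneg μ)
      rw [hx]; nlinarith
    have h2 : Real.exp (μ * |W ω|) ≤ Real.exp (D * x) * Real.exp (c * H ω) := by
      rw [← Real.exp_add]; gcongr
    have h3 := mul_le_mul h1 h2 (Real.exp_pos _).le (by positivity)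
    have h4 : Real.exp (2 * c * H ω) = Real.exp (c * H ω) * Real.exp (c * H ω) := by
      rw [← Real.exp_add]; ring_nf
    rw [h4]
    linarith
  have hi1 : Integrable (fun ω => 1 + μ * W ω) P := (integrable_const 1).add (hiW.const_mul μ)
  have hi2 : Integrable (fun ω => x * q * Real.exp (D * x) * Real.exp (2 * c * H ω)) P :=
    hint.const_mul _
  have hi : Integrable (fun ω => Real.exp (μ * W ω)) P :=
    (hi1.add hi2).mono' (by fun_prop) (hpt.mono fun ω h => by
      rw [Real.norm_of_nonneg (Real.exp_pos _).le]; exact h)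
  have hsplit : ∀ ω, Real.exp (μ * (W ω - ∫ ω', W ω' ∂P))
      = Real.exp (-v) * Real.exp (μ * W ω) := fun ω => by
    rw [← Real.exp_add, hv]; ring_nf
  have hE : ∫ ω, Real.exp (μ * W ω) ∂P ≤ 1 + v + 3 * q * x * Real.exp (D * x) := by
    refine (integral_mono_ae hi (hi1.add hi2) hpt).trans ?_
    rw [integral_add' hi1 hi2, integral_add (integrable_const 1) (hiW.const_mul μ),
      integral_const_mul, integral_const_mul]
    simp only [integral_const, probReal_univ, smul_eq_mul, mul_one]
    have := mul_le_mul_of_nonneg_left hle (by positivity : 0 ≤ x * q * Real.exp (D * x))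
    linarith
  refine ⟨by simp_rw [hsplit]; exact hi.const_mul _, ?_⟩
  simp only [mgf, hsplit]
  rw [integral_const_mul]
  have hG : -v ≤ 1 + 3 * q * x := by
    have : v ^ 2 ≤ 3 * q * x := by
      have := mul_le_mul_of_nonneg_left hEW (sq_nonneg μ)
      rw [hv, hx, mul_pow]; linarith
    nlinarith [sq_nonneg (v + 1)]
  -- The centring factor `exp(-v)` cancels `1 + v ≤ exp v`, so only terms of order `μ² δ²` remain.
  calc Real.exp (-v) * ∫ ω, Real.exp (μ * W ω) ∂P
      ≤ Real.exp (-v) * (Real.exp v + 3 * q * x * Real.exp (D * x)) := by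
        gcongr
        exact hE.trans (by linarith [Real.add_one_le_exp v])
    _ = 1 + 3 * q * x * Real.exp (D * x) * Real.exp (-v) := by
        rw [mul_add, ← Real.exp_add, neg_add_cancel, Real.exp_zero]; ring
    _ ≤ 1 + 3 * q * x * Real.exp (D * x) * Real.exp (1 + 3 * q * x) := by gcongr
    _ ≤ 1 + 9 * q * x * Real.exp (D * x + 3 * q * x) := by
        rw [Real.exp_add 1, Real.exp_add (D * x)]
        have : Real.exp 1 ≤ 3 := Real.exp_one_lt_three.le
        have := mul_le_mul_of_nonneg_left this
          (by positivity : 0 ≤ 3 * q * x * Real.exp (D * x) * Real.exp (3 * q * x))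
        linarith
    _ ≤ (1 + 9 * q * x) * Real.exp (D * x + 3 * q * x) := by
        have : 1 ≤ Real.exp (D * x + 3 * q * x) := Real.one_le_exp (by positivity)
        linarith
    _ ≤ Real.exp (9 * q * x) * Real.exp (D * x + 3 * q * x) := by
        gcongr
        linarith [Real.add_one_le_exp (9 * q * x)]
    _ = _ := by rw [← Real.exp_add, hq]; ring_nf

end

/-! ### Nets of the unit ball and the chaining inequality -/

/-- A bounded set of diameter comparable to `δ` has a `δ`-net with at most `5 ^ d` points. -/
lemma exists_finset_net_of_subset_closedBall {d : ℕ} (T : Set (EuclideanSpace ℝ (Fin d)))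
    (y : EuclideanSpace ℝ (Fin d)) {δ : ℝ} (hδ : 0 < δ) (hT : T ⊆ Metric.closedBall y (2 * δ)) :
    ∃ s : Finset (EuclideanSpace ℝ (Fin d)), ↑s ⊆ T ∧ s.card ≤ 5 ^ d ∧
      ∀ x ∈ T, ∃ z ∈ s, ‖x - z‖ ≤ δ := by
  classical
  let S : Set ℕ := {m | ∃ s : Finset (EuclideanSpace ℝ (Fin d)), ↑s ⊆ T ∧
    (∀ b ∈ s, ∀ c ∈ s, b ≠ c → δ < ‖b - c‖) ∧ s.card = m}
  have hcard : ∀ s : Finset (EuclideanSpace ℝ (Fin d)), ↑s ⊆ T →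
      (∀ b ∈ s, ∀ c ∈ s, b ≠ c → δ < ‖b - c‖) → s.card ≤ 5 ^ d := by
    intro s hs hsep
    have hinj : Function.Injective fun b : EuclideanSpace ℝ (Fin d) => δ⁻¹ • (b - y) := by
      intro b c h
      simpa [hδ.ne'] using h
    have := Besicovitch.card_le_of_separated (s.image fun b => δ⁻¹ • (b - y)) ?_ ?_
    · rwa [Finset.card_image_of_injective _ hinj, finrank_euclideanSpace_fin] at this
    · simp only [Finset.mem_image, forall_exists_index, and_imp, forall_apply_eq_imp_iff₂]
      intro b hb
      have := mem_closedBall_iff_norm.mp (hT (hs hb))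
      rw [norm_smul, norm_inv, Real.norm_of_nonneg hδ.le, inv_mul_le_iff₀ hδ]
      linarith
    · simp only [Finset.mem_image, forall_exists_index, and_imp, forall_apply_eq_imp_iff₂]
      intro b hb c hc hbc
      have := hsep b hb c hc (fun h => hbc (by rw [h]))
      rw [← smul_sub, norm_smul, norm_inv, Real.norm_of_nonneg hδ.le, le_inv_mul_iff₀ hδ,
        sub_sub_sub_cancel_right]
      linarith
  have hne : S.Nonempty := ⟨0, ∅, by simp, by simp, rfl⟩
  have hbdd : BddAbove S := ⟨5 ^ d, by rintro _ ⟨s, h1, h2, rfl⟩; exact hcard s h1 h2⟩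
  -- A separated set of maximal size is a net: an uncovered point could be added to it.
  obtain ⟨s, hs, hsep, hmax⟩ := Nat.sSup_mem hne hbdd
  refine ⟨s, hs, hcard s hs hsep, fun x hx => ?_⟩
  by_contra! hcon
  have hxs : x ∉ s := fun h => by
    have := hcon x h
    simp at this
    linarith
  have hmem : s.card + 1 ∈ S := by
    refine ⟨insert x s, ?_, ?_, Finset.card_insert_of_notMem hxs⟩
    · rw [Finset.coe_insert]; exact Set.insert_subset hx hs
    · intro b hb c hc hbc
      rcases Finset.mem_insert.1 hb with rfl | hb' <;>
        rcases Finset.mem_insert.1 hc with rfl | hc'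
      · exact absurd rfl hbc
      · exact hcon c hc'
      · rw [norm_sub_rev]; exact hcon b hb'
      · exact hsep b hb' c hc' hbc
  have := le_csSup hbdd hmem
  omega

/-- Dyadic nets of the unit ball. -/
lemma exists_dyadic_nets (d : ℕ) : ∃ N : ℕ → Finset (EuclideanSpace ℝ (Fin d)), N 0 = {0} ∧
    ∀ l, ↑(N l) ⊆ Metric.closedBall (0 : EuclideanSpace ℝ (Fin d)) 1 ∧ (N l).card ≤ 5 ^ (d * l) ∧
      ∀ x ∈ Metric.closedBall (0 : EuclideanSpace ℝ (Fin d)) 1,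
        ∃ z ∈ N l, ‖x - z‖ ≤ (1 / 2) ^ l := by
  classical
  -- Refining locally, around each point of the previous net, costs a factor `5 ^ d` per level.
  -- Intersecting with the unit ball keeps the net points inside it.
  have hstep : ∀ (l : ℕ) (y : EuclideanSpace ℝ (Fin d)),
      ∃ s : Finset (EuclideanSpace ℝ (Fin d)),
      ↑s ⊆ Metric.closedBall (0 : EuclideanSpace ℝ (Fin d)) 1 ∩ Metric.closedBall y ((1 / 2) ^ l) ∧
      s.card ≤ 5 ^ d ∧
      ∀ x ∈ Metric.closedBall (0 : EuclideanSpace ℝ (Fin d)) 1 ∩ Metric.closedBall y ((1 / 2) ^ l),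
        ∃ z ∈ s, ‖x - z‖ ≤ (1 / 2) ^ (l + 1) := fun l y =>
    exists_finset_net_of_subset_closedBall _ y (by positivity)
      (Set.inter_subset_right.trans (Metric.closedBall_subset_closedBall (by
        rw [pow_succ]; linarith)))
  choose s hs1 hs2 hs3 using hstep
  let N : ℕ → Finset (EuclideanSpace ℝ (Fin d)) := fun l =>
    Nat.rec {0} (fun l M => M.biUnion (s l)) l
  have hN : ∀ l, N (l + 1) = (N l).biUnion (s l) := fun l => rfl
  refine ⟨N, rfl, fun l => ?_⟩
  induction l with
  | zero => exact ⟨by simp [N], by simp [N], fun x hx => ⟨0, by simp [N], by simpa using hx⟩⟩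
  | succ l ih =>
    obtain ⟨h1, h2, h3⟩ := ih
    refine ⟨?_, ?_, fun x hx => ?_⟩
    · rw [hN, Finset.coe_biUnion]
      exact Set.iUnion₂_subset fun y _ => (hs1 l y).trans Set.inter_subset_left
    · rw [hN]
      refine Finset.card_biUnion_le.trans ((Finset.sum_le_card_nsmul _ _ _ fun y _ => hs2 l y).trans ?_)
      rw [smul_eq_mul, mul_add, mul_one, pow_add]
      gcongr
    · obtain ⟨y, hy, hxy⟩ := h3 x hx
      obtain ⟨z, hz, hxz⟩ := hs3 l y x ⟨hx, mem_closedBall_iff_norm.2 hxy⟩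
      exact ⟨z, by rw [hN]; exact Finset.mem_biUnion.2 ⟨y, hy, hz⟩, hxz⟩

/-- Telescoping bounds `Z` along the chain; continuity passes to the limit point. -/
lemma le_tsum_of_chaining {X : Type*} [TopologicalSpace X] {Z : X → ℝ} (hZ : Continuous Z)
    {x : X} {p : ℕ → X} (hp : Filter.Tendsto p Filter.atTop (nhds x)) {t : ℕ → ℝ}
    (ht : Summable t) (ht0 : ∀ l, 0 ≤ t l) (h0 : Z (p 0) ≤ 0)
    (hinc : ∀ l, Z (p (l + 1)) - Z (p l) ≤ t l) : Z x ≤ ∑' l, t l := by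
  refine le_of_tendsto ((hZ.tendsto x).comp hp) (Filter.Eventually.of_forall fun m => ?_)
  have h : Z (p m) ≤ ∑ l ∈ Finset.range m, t l := by
    have := Finset.sum_le_sum fun l (_ : l ∈ Finset.range m) => hinc l
    rw [Finset.sum_range_sub (fun l => Z (p l))] at this
    linarith
  exact h.trans (ht.sum_le_tsum _ fun l _ => ht0 l)

/-! ### Increments of products of ridge functions -/

/-- The product of ridge functions `v ↦ ∏ₖ φₖ(vᵀxₖ)`. -/
noncomputable def ridgeProd {r d : ℕ} (φ : Fin r → ℝ → ℝ) (x : Fin r → EuclideanSpace ℝ (Fin d))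
    (v : EuclideanSpace ℝ (Fin d)) : ℝ :=
  ∏ k, φ k (inner ℝ v (x k))

/-- The directions controlling the increment of `ridgeProd` between `x` and `y` at scale `δ`. -/
noncomputable def incrementDirs {r d : ℕ} (x y : Fin r → EuclideanSpace ℝ (Fin d)) (δ : ℝ) :
    Fin r ⊕ Fin r ⊕ Fin r → EuclideanSpace ℝ (Fin d) :=
  Sum.elim x (Sum.elim y fun k => δ⁻¹ • (x k - y k))

/-- The squared envelope of the increment of `ridgeProd` between `x` and `y` at scale `δ`. -/
noncomputable def incrementEnvelope {r d : ℕ} (x y : Fin r → EuclideanSpace ℝ (Fin d)) (δ : ℝ)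
    (v : EuclideanSpace ℝ (Fin d)) : ℝ :=
  ∑ i, inner ℝ v (incrementDirs x y δ i) ^ 2

section ridge

variable {r d : ℕ} {φ : Fin r → ℝ → ℝ}

lemma continuous_ridgeProd_left (hφ : ∀ k, LipschitzWith 1 (φ k))
    (v : EuclideanSpace ℝ (Fin d)) : Continuous fun x => ridgeProd φ x v := by
  refine continuous_finsetProd _ fun k _ => (hφ k).continuous.comp ?_
  fun_prop

lemma continuous_ridgeProd (hφ : ∀ k, LipschitzWith 1 (φ k))
    (x : Fin r → EuclideanSpace ℝ (Fin d)) : Continuous (ridgeProd φ x) := by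
  refine continuous_finsetProd _ fun k _ => (hφ k).continuous.comp ?_
  fun_prop

lemma incrementEnvelope_nonneg (x y : Fin r → EuclideanSpace ℝ (Fin d)) (δ : ℝ)
    (v : EuclideanSpace ℝ (Fin d)) : 0 ≤ incrementEnvelope x y δ v :=
  Finset.sum_nonneg fun _ _ => sq_nonneg _

lemma abs_inner_le_sqrt_incrementEnvelope (x y : Fin r → EuclideanSpace ℝ (Fin d)) (δ : ℝ)
    (v : EuclideanSpace ℝ (Fin d)) (i : Fin r ⊕ Fin r ⊕ Fin r) :
    |inner ℝ v (incrementDirs x y δ i)| ≤ √(incrementEnvelope x y δ v) := by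
  rw [← Real.sqrt_sq_eq_abs]
  exact Real.sqrt_le_sqrt (Finset.single_le_sum
    (f := fun i => inner ℝ v (incrementDirs x y δ i) ^ 2) (fun _ _ => sq_nonneg _)
    (Finset.mem_univ i))

lemma abs_ridgeProd_sub_le (hφ0 : ∀ k, φ k 0 = 0) (hφ : ∀ k, LipschitzWith 1 (φ k))
    (x y : Fin r → EuclideanSpace ℝ (Fin d)) {δ : ℝ} (hδ : 0 < δ)
    (v : EuclideanSpace ℝ (Fin d)) :
    |ridgeProd φ x v - ridgeProd φ y v| ≤ r * δ * √(incrementEnvelope x y δ v) ^ r := by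
  have hlip : ∀ k s t, |φ k s - φ k t| ≤ |s - t| := fun k s t => by
    simpa [Real.dist_eq] using (hφ k).dist_le_mul s t
  have habs : ∀ k s, |φ k s| ≤ |s| := fun k s => by simpa [hφ0] using hlip k s 0
  have hH := abs_inner_le_sqrt_incrementEnvelope x y δ v
  have := abs_prod_sub_prod_le Finset.univ (fun k => φ k (inner ℝ v (x k)))
    (fun k => φ k (inner ℝ v (y k))) (Real.sqrt_nonneg (incrementEnvelope x y δ v)) hδ.le
    (fun k => (habs k _).trans (hH (Sum.inl k)))
    (fun k => (habs k _).trans (hH (Sum.inr (Sum.inl k)))) (fun k => ?_)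
  · simpa [ridgeProd] using this
  · refine (hlip k _ _).trans ?_
    have h := hH (Sum.inr (Sum.inr k))
    simp only [incrementDirs, Sum.elim_inr, inner_smul_right, abs_mul, abs_inv, abs_of_pos hδ,
      inv_mul_le_iff₀ hδ, inner_sub_right] at h
    exact h

variable {Ω : Type*} [MeasurableSpace Ω] {P : Measure Ω}
  {a : Ω → EuclideanSpace ℝ (Fin d)} {B : Fin r → ℝ}

lemma ae_abs_ridgeProd_le
    (hB : ∀ k, ∀ᵐ ω ∂P, ∀ x ∈ Metric.closedBall (0 : EuclideanSpace ℝ (Fin d)) 1,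
      |φ k (inner ℝ (a ω) x)| ≤ B k) :
    ∀ᵐ ω ∂P, ∀ x : Fin r → EuclideanSpace ℝ (Fin d), (∀ k, ‖x k‖ ≤ 1) →
      |ridgeProd φ x (a ω)| ≤ ∏ k, B k := by
  filter_upwards [ae_all_iff.2 hB] with ω hω x hx
  rw [ridgeProd, Finset.abs_prod]
  exact Finset.prod_le_prod (fun _ _ => abs_nonneg _) fun k _ =>
    hω k _ (mem_closedBall_zero_iff.2 (hx k))

variable [IsProbabilityMeasure P]

/-- All `3r` directions have norm at most 1, the rescaled differences included, so the
mean-of-squares bound applies; `2/(24r)` is `1/(4 · 3r)`. -/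
lemma integrable_exp_incrementEnvelope (hr : 1 ≤ r) (ha : Measurable a)
    (hsub : IsSubGaussianVector P 1 a) {x y : Fin r → EuclideanSpace ℝ (Fin d)} {δ : ℝ}
    (hδ : 0 < δ) (hx : ∀ k, ‖x k‖ ≤ 1) (hy : ∀ k, ‖y k‖ ≤ 1) (hxy : ∀ k, ‖x k - y k‖ ≤ δ) :
    Integrable (fun ω => Real.exp (2 * (1 / (24 * r)) * incrementEnvelope x y δ (a ω))) P ∧
      ∫ ω, Real.exp (2 * (1 / (24 * r)) * incrementEnvelope x y δ (a ω)) ∂P ≤ 3 := by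
  have : Nonempty (Fin r) := ⟨⟨0, hr⟩⟩
  have hr' : (0 : ℝ) < r := by exact_mod_cast hr
  have hdir : ∀ i, ‖incrementDirs x y δ i‖ ≤ 1 := by
    rintro (k | k | k)
    · exact hx k
    · exact hy k
    · simp only [incrementDirs, Sum.elim_inr, norm_smul, norm_inv, Real.norm_of_nonneg hδ.le]
      rw [inv_mul_le_iff₀ hδ, mul_one]
      exact hxy k
  have key := integrable_exp_mean_sq (P := P)
    (g := fun i ω => inner ℝ (a ω) (incrementDirs x y δ i)) (fun i => by fun_prop)
    (fun i ε hε => ?_)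
  · have hcard : (4 * (Fintype.card (Fin r ⊕ Fin r ⊕ Fin r) : ℝ)) = 12 * r := by
      simp; ring
    rw [hcard] at key
    have : ∀ ω, (∑ i, inner ℝ (a ω) (incrementDirs x y δ i) ^ 2) / (12 * (r : ℝ))
        = 2 * (1 / (24 * r)) * incrementEnvelope x y δ (a ω) := fun ω => by
      rw [incrementEnvelope]
      generalize ∑ i, (inner ℝ (a ω) (incrementDirs x y δ i) : ℝ) ^ 2 = S
      field_simp
      ring
    simpa only [this] using key
  -- At a zero direction division by zero makes the hypothesis the void bound 2, but the event is
  -- empty.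
  · rcases eq_or_ne (incrementDirs x y δ i) 0 with h0 | h0
    · have hempty : {ω | ε ≤ |(inner ℝ (a ω) (incrementDirs x y δ i) : ℝ)|} = ∅ := by
        ext ω; simp [h0, hε]
      rw [hempty, measureReal_empty]
      positivity
    · have h := hsub ε hε _ (mem_closedBall_zero_iff.2 (hdir i))
      rw [one_mul] at h
      refine h.trans ?_
      have : 0 < ‖incrementDirs x y δ i‖ := norm_pos_iff.2 h0
      gcongr
      nlinarith [hdir i]

lemma bound_nonneg (hφ0 : ∀ k, φ k 0 = 0)
    (hB : ∀ k, ∀ᵐ ω ∂P, ∀ x ∈ Metric.closedBall (0 : EuclideanSpace ℝ (Fin d)) 1,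
      |φ k (inner ℝ (a ω) x)| ≤ B k) (k : Fin r) : 0 ≤ B k := by
  obtain ⟨ω, hω⟩ := (hB k).exists
  simpa [hφ0] using hω 0 (by simp)

lemma integrable_ridgeProd (ha : Measurable a) (hφ : ∀ k, LipschitzWith 1 (φ k))
    (hB : ∀ k, ∀ᵐ ω ∂P, ∀ x ∈ Metric.closedBall (0 : EuclideanSpace ℝ (Fin d)) 1,
      |φ k (inner ℝ (a ω) x)| ≤ B k) {x : Fin r → EuclideanSpace ℝ (Fin d)}
    (hx : ∀ k, ‖x k‖ ≤ 1) : Integrable (fun ω => ridgeProd φ x (a ω)) P :=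
  Integrable.of_bound ((continuous_ridgeProd hφ x).measurable.comp ha).aestronglyMeasurable
    (∏ k, B k) ((ae_abs_ridgeProd_le hB).mono fun _ h => h x hx)

/-- `w ^ (2 / r)` is quadratic in the envelope, and the remaining factor of `w` is bounded. -/
lemma mul_le_of_rpow_bound (hr : 2 ≤ r) {w b δ μ H : ℝ} (hw : 0 ≤ w) (hb : 0 ≤ b) (hδ : 0 < δ)
    (hH : 0 ≤ H) (hμ : 0 ≤ μ) (hwb : w ≤ 2 * b) (hwH : w ≤ r * δ * √H ^ r)
    (h : μ * (δ ^ (2 / (r : ℝ)) * b ^ (1 - 2 / (r : ℝ))) ≤ 1 / (48 * r ^ 2)) :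
    μ * w ≤ 1 / (24 * r) * H := by
  have hr2 : (2 : ℝ) ≤ r := by exact_mod_cast hr
  have hr0 : (0 : ℝ) < r := by linarith
  set e : ℝ := 2 / (r : ℝ) with he
  have he0 : 0 ≤ e := by positivity
  have he1 : e ≤ 1 := (div_le_one hr0).2 hr2
  have h1 : w ^ (1 - e) ≤ 2 * b ^ (1 - e) := by
    calc w ^ (1 - e) ≤ (2 * b) ^ (1 - e) := Real.rpow_le_rpow hw hwb (by linarith)
      _ = 2 ^ (1 - e) * b ^ (1 - e) := Real.mul_rpow (by norm_num) hb
      _ ≤ 2 ^ (1 : ℝ) * b ^ (1 - e) := by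
          gcongr
          · norm_num
          · linarith
      _ = 2 * b ^ (1 - e) := by rw [Real.rpow_one]
  have h2 : w ^ e ≤ r * δ ^ e * H := by
    calc w ^ e ≤ (r * δ * √H ^ r) ^ e := Real.rpow_le_rpow hw hwH he0
      _ = r ^ e * δ ^ e * (√H ^ r) ^ e := by
          rw [Real.mul_rpow (by positivity) (by positivity), Real.mul_rpow hr0.le hδ.le]
      _ = r ^ e * δ ^ e * H := by
          rw [← Real.rpow_natCast, ← Real.rpow_mul (Real.sqrt_nonneg _), he,
            mul_div_cancel₀ _ hr0.ne', Real.rpow_two, Real.sq_sqrt hH]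
      _ ≤ r ^ (1 : ℝ) * δ ^ e * H := by
          gcongr
          linarith
      _ = r * δ ^ e * H := by rw [Real.rpow_one]
  have h3 : w = w ^ (1 - e) * w ^ e := by
    rw [← Real.rpow_add' hw (by simp), sub_add_cancel, Real.rpow_one]
  calc μ * w = μ * (w ^ (1 - e) * w ^ e) := by rw [← h3]
    _ ≤ μ * ((2 * b ^ (1 - e)) * (r * δ ^ e * H)) := by gcongr
    _ = (μ * (δ ^ e * b ^ (1 - e))) * (2 * r * H) := by ring
    _ ≤ 1 / (48 * r ^ 2) * (2 * r * H) := by gcongr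
    _ = 1 / (24 * r) * H := by field_simp; ring

/-- The constant in the Gaussian bound of the moment generating function of an increment. -/
noncomputable def mgfConst (r : ℕ) : ℝ :=
  4 * (3 * r ^ 2 * (r.factorial / (1 / (24 * (r : ℝ))) ^ r)) + 6 * r

lemma mgf_increment_le (hr : 1 ≤ r) (ha : Measurable a) (hsub : IsSubGaussianVector P 1 a)
    (hφ0 : ∀ k, φ k 0 = 0) (hφ : ∀ k, LipschitzWith 1 (φ k))
    (hB : ∀ k, ∀ᵐ ω ∂P, ∀ x ∈ Metric.closedBall (0 : EuclideanSpace ℝ (Fin d)) 1,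
      |φ k (inner ℝ (a ω) x)| ≤ B k) {K : ℝ}
    (hK : r = 1 ∨ (2 ≤ r ∧ K = (∏ k, B k) ^ (1 - 2 / (r : ℝ))))
    {x y : Fin r → EuclideanSpace ℝ (Fin d)} {δ μ : ℝ}
    (hδ : 0 < δ) (hx : ∀ k, ‖x k‖ ≤ 1) (hy : ∀ k, ‖y k‖ ≤ 1) (hxy : ∀ k, ‖x k - y k‖ ≤ δ)
    (hμ : 0 ≤ μ) (hμK : μ * (δ ^ (2 / (r : ℝ)) * K) ≤ 1 / (48 * r ^ 2)) :
    Integrable (fun ω => Real.exp (μ * (ridgeProd φ x (a ω) - ridgeProd φ y (a ω)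
      - ∫ ω', (ridgeProd φ x (a ω') - ridgeProd φ y (a ω')) ∂P))) P ∧
    mgf (fun ω => ridgeProd φ x (a ω) - ridgeProd φ y (a ω)
      - ∫ ω', (ridgeProd φ x (a ω') - ridgeProd φ y (a ω')) ∂P) P μ
      ≤ Real.exp (mgfConst r * (μ ^ 2 * δ ^ 2)) := by
  have hr' : (0 : ℝ) < r := by exact_mod_cast hr
  obtain ⟨hint, hle⟩ := integrable_exp_incrementEnvelope hr ha hsub hδ hx hy hxy
  have hdiff := abs_ridgeProd_sub_le hφ0 hφ x y hδ
  refine mgf_sub_integral_le (W := fun ω => ridgeProd φ x (a ω) - ridgeProd φ y (a ω))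
    (H := fun ω => incrementEnvelope x y δ (a ω))
    (((continuous_ridgeProd hφ x).sub (continuous_ridgeProd hφ y)).measurable.comp ha)
    (fun ω => incrementEnvelope_nonneg x y δ _) (c := 1 / (24 * r)) (D := 6 * r) (r := r)
    (by positivity) (by positivity) hint hle (fun ω => ?_) hμ ?_
  · rw [← sq_abs]
    refine (pow_le_pow_left₀ (abs_nonneg _) (hdiff (a ω)) 2).trans_eq ?_
    rw [mul_pow, mul_pow, ← pow_mul, mul_comm r 2, pow_mul,
      Real.sq_sqrt (incrementEnvelope_nonneg x y δ _)]
    ring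
  · filter_upwards [ae_abs_ridgeProd_le hB] with ω hω
    have hH := incrementEnvelope_nonneg x y δ (a ω)
    rcases hK with rfl | ⟨hr2, rfl⟩
    · have h := mul_le_mul_of_nonneg_left (hdiff (a ω)) hμ
      have hs := Real.sq_sqrt hH
      simp only [Nat.cast_one, pow_one] at h ⊢
      -- For r = 1, `μ δ √H ≤ 6 μ² δ² + H / 24`, which is where `D = 6 r` comes from.
      nlinarith [sq_nonneg (√(incrementEnvelope x y δ (a ω)) - 12 * (μ * δ))]
    · have h2 : |ridgeProd φ x (a ω) - ridgeProd φ y (a ω)| ≤ 2 * ∏ k, B k := by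
        linarith [abs_sub (ridgeProd φ x (a ω)) (ridgeProd φ y (a ω)), hω x hx, hω y hy]
      have := mul_le_of_rpow_bound hr2 (abs_nonneg _)
        (Finset.prod_nonneg fun k _ => bound_nonneg hφ0 hB k) hδ hH hμ h2 (hdiff (a ω)) hμK
      have h0 : 0 ≤ 6 * (r : ℝ) * (μ ^ 2 * δ ^ 2) := by positivity
      linarith

end ridge

/-! ### Continuity and increment tails of the empirical process -/

/-- The centred empirical mean of `ridgeProd φ x`. -/
noncomputable def deviation {r d n : ℕ} {Ω : Type*} [MeasurableSpace Ω] (P : Measure Ω)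
    (φ : Fin r → ℝ → ℝ) (a : Ω → EuclideanSpace ℝ (Fin d))
    (A : Fin n → Ω → EuclideanSpace ℝ (Fin d)) (x : Fin r → EuclideanSpace ℝ (Fin d))
    (ω : Ω) : ℝ :=
  (1 / (n : ℝ)) * ∑ i : Fin n, (ridgeProd φ x (A i ω) - ∫ ω', ridgeProd φ x (a ω') ∂P)

section deviation

variable {r d n : ℕ} {φ : Fin r → ℝ → ℝ} {Ω : Type*} [MeasurableSpace Ω] {P : Measure Ω}
  [IsProbabilityMeasure P] {a : Ω → EuclideanSpace ℝ (Fin d)}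
  {A : Fin n → Ω → EuclideanSpace ℝ (Fin d)} {B : Fin r → ℝ}

lemma continuous_deviation (ha : Measurable a) (hφ : ∀ k, LipschitzWith 1 (φ k))
    (hB : ∀ k, ∀ᵐ ω ∂P, ∀ x ∈ Metric.closedBall (0 : EuclideanSpace ℝ (Fin d)) 1,
      |φ k (inner ℝ (a ω) x)| ≤ B k) (ω : Ω) :
    Continuous fun x : Fin r → Metric.closedBall (0 : EuclideanSpace ℝ (Fin d)) 1 =>
      deviation P φ a A (fun k => x k) ω := by
  have hval : Continuous fun (x : Fin r → Metric.closedBall (0 : EuclideanSpace ℝ (Fin d)) 1)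
      (k : Fin r) => (x k : EuclideanSpace ℝ (Fin d)) := by fun_prop
  refine continuous_const.mul (continuous_finsetSum _ fun i _ =>
    ((continuous_ridgeProd_left hφ _).comp hval).sub ?_)
  refine continuous_of_dominated (bound := fun _ => ∏ k, B k) (fun x => ?_) (fun x => ?_)
    (integrable_const _) (Filter.Eventually.of_forall fun ω' => ?_)
  · exact ((continuous_ridgeProd hφ _).measurable.comp ha).aestronglyMeasurable
  · exact (ae_abs_ridgeProd_le hB).mono fun ω' h =>
      h _ fun k => mem_closedBall_zero_iff.1 (x k).2
  · exact (continuous_ridgeProd_left hφ _).comp hval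

lemma deviation_increment_tail (hr : 1 ≤ r) (hd : 1 ≤ d) (hn : 1 ≤ n) (ha : Measurable a)
    (hA : ∀ i, Measurable (A i)) (hind : iIndepFun A P) (hid : ∀ i, IdentDistrib (A i) a P P)
    (hsub : IsSubGaussianVector P 1 a)
    (hφ0 : ∀ k, φ k 0 = 0) (hφ : ∀ k, LipschitzWith 1 (φ k))
    (hB : ∀ k, ∀ᵐ ω ∂P, ∀ x ∈ Metric.closedBall (0 : EuclideanSpace ℝ (Fin d)) 1,
      |φ k (inner ℝ (a ω) x)| ≤ B k) {K : ℝ} (hK0 : 0 ≤ K)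
    (hK : r = 1 ∨ (2 ≤ r ∧ K = (∏ k, B k) ^ (1 - 2 / (r : ℝ))))
    {x y : Fin r → EuclideanSpace ℝ (Fin d)} {δ : ℝ}
    (hδ : 0 < δ) (hx : ∀ k, ‖x k‖ ≤ 1) (hy : ∀ k, ‖y k‖ ≤ 1) (hxy : ∀ k, ‖x k - y k‖ ≤ δ)
    (L : ℝ) :
    P.real {ω | L / n * (δ * √(n / d) + δ ^ (2 / (r : ℝ)) * K)
        ≤ deviation P φ a A x ω - deviation P φ a A y ω}
      ≤ Real.exp (mgfConst r * d - L / (48 * r ^ 2)) := by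
  have hn0 : (0 : ℝ) < n := by exact_mod_cast hn
  have hd0 : (0 : ℝ) < d := by exact_mod_cast hd
  have hr1 : (1 : ℝ) ≤ r := by exact_mod_cast hr
  set s : ℝ := δ * √(n / d) + δ ^ (2 / (r : ℝ)) * K with hs
  have hs1 : 0 < δ * √(n / d) := by positivity
  have hs2 : 0 ≤ δ ^ (2 / (r : ℝ)) * K := by positivity
  have hs0 : 0 < s := by linarith
  -- The two summands of `s` serve two constraints: the first gives `n μ² δ² ≤ d`, so the moment
  -- generating function of the sum costs only `exp(mgfConst r * d)`; the second keeps `μ` in the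
  -- admissible range.
  set μ : ℝ := 1 / (48 * r ^ 2) / s with hμdef
  have hμ : 0 ≤ μ := by positivity
  have hμs : μ * s = 1 / (48 * r ^ 2) := div_mul_cancel₀ _ hs0.ne'
  have hμK : μ * (δ ^ (2 / (r : ℝ)) * K) ≤ 1 / (48 * r ^ 2) := by
    rw [← hμs]; gcongr; linarith
  have hμd : n * (μ ^ 2 * δ ^ 2) ≤ d := by
    have h1 : μ * (δ * √(n / d)) ≤ 1 := by
      calc μ * (δ * √(n / d)) ≤ μ * s := by gcongr; linarith
        _ = 1 / (48 * r ^ 2) := hμs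
        _ ≤ 1 := by rw [div_le_one (by positivity)]; nlinarith
    have h2 := pow_le_one₀ (n := 2) (by positivity) h1
    rw [mul_pow, mul_pow, Real.sq_sqrt (by positivity), ← mul_assoc, mul_div_assoc',
      div_le_one hd0] at h2
    linarith
  set m : ℝ := ∫ ω, (ridgeProd φ x (a ω) - ridgeProd φ y (a ω)) ∂P with hm
  obtain ⟨hint, hmgf⟩ := mgf_increment_le hr ha hsub hφ0 hφ hB hK hδ hx hy hxy hμ hμK
  let f : EuclideanSpace ℝ (Fin d) → ℝ := fun v => ridgeProd φ x v - ridgeProd φ y v - m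
  have hf : Measurable f := (((continuous_ridgeProd hφ x).sub
    (continuous_ridgeProd hφ y)).sub continuous_const).measurable
  have hidf : ∀ i, IdentDistrib (f ∘ A i) (f ∘ a) P P := fun i => (hid i).comp hf
  have hindf : iIndepFun (fun i => f ∘ A i) P := hind.comp (fun _ => f) fun _ => hf
  have hmeas : ∀ i, Measurable (f ∘ A i) := fun i => hf.comp (hA i)
  have hintS : Integrable (fun ω => Real.exp (μ * (∑ i, f ∘ A i) ω)) P := by
    refine hindf.integrable_exp_mul_sum hmeas fun i _ => ?_
    exact (((hidf i).comp (measurable_const_mul μ).exp).integrable_iff).2 hint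
  have hmgfS : mgf (∑ i, f ∘ A i) P μ ≤ Real.exp (mgfConst r * d) := by
    have hC : 0 ≤ mgfConst r := by unfold mgfConst; positivity
    rw [hindf.mgf_sum hmeas]
    calc ∏ i, mgf (f ∘ A i) P μ ≤ ∏ _i : Fin n, Real.exp (mgfConst r * (μ ^ 2 * δ ^ 2)) :=
          Finset.prod_le_prod (fun _ _ => mgf_nonneg) fun i _ => by
            rw [mgf_congr_identDistrib (hidf i)]; exact hmgf
      _ = Real.exp (mgfConst r * (n * (μ ^ 2 * δ ^ 2))) := by
          rw [Finset.prod_const, ← Real.exp_nat_mul, Finset.card_univ, Fintype.card_fin]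
          ring_nf
      _ ≤ _ := by gcongr
  have hsum : ∀ ω, (n : ℝ) * (deviation P φ a A x ω - deviation P φ a A y ω)
      = (∑ i, f ∘ A i) ω := fun ω => by
    rw [deviation, deviation, ← mul_sub, ← mul_assoc, mul_one_div_cancel hn0.ne', one_mul,
      ← Finset.sum_sub_distrib, Finset.sum_apply]
    refine Finset.sum_congr rfl fun i _ => ?_
    simp only [f, Function.comp_apply, hm]
    rw [integral_sub (integrable_ridgeProd ha hφ hB hx) (integrable_ridgeProd ha hφ hB hy)]
    ring
  calc _ ≤ P.real {ω | L * s ≤ (∑ i, f ∘ A i) ω} := by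
        refine measureReal_mono fun ω hω => ?_
        have := mul_le_mul_of_nonneg_left (show _ ≤ _ from hω) hn0.le
        rw [hsum, ← mul_assoc, mul_div_cancel₀ _ hn0.ne'] at this
        exact this
    _ ≤ Real.exp (-μ * (L * s)) * mgf (∑ i, f ∘ A i) P μ := measure_ge_le_exp_mul_mgf _ hμ hintS
    _ ≤ Real.exp (-μ * (L * s)) * Real.exp (mgfConst r * d) := by gcongr
    _ = _ := by
        rw [← Real.exp_add, show -μ * (L * s) = -((μ * s) * L) by ring, hμs]
        ring_nf

end deviation

/-! ### Constants and summation over levels -/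

lemma summable_succ_mul_dyadic_rpow {e : ℝ} (he : 0 < e) :
    Summable fun l : ℕ => ((l : ℝ) + 1) * (2 * (1 / 2) ^ l) ^ e := by
  have hq0 : (0 : ℝ) ≤ (1 / 2 : ℝ) ^ e := by positivity
  have hq1 : ‖(1 / 2 : ℝ) ^ e‖ < 1 := by
    rw [Real.norm_of_nonneg hq0]
    exact Real.rpow_lt_one (by norm_num) (by norm_num) he
  have h1 := (summable_pow_mul_geometric_of_norm_lt_one 1 hq1).add
    (summable_pow_mul_geometric_of_norm_lt_one 0 hq1)
  refine (h1.mul_left ((2 : ℝ) ^ e)).congr fun l => ?_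
  rw [Real.mul_rpow (by norm_num) (by positivity), ← Real.rpow_pow_comm (by norm_num)]
  ring

/-- The chaining constant in the deviation bound. -/
noncomputable def chainConst (r : ℕ) : ℝ :=
  48 * r ^ 2 * (4 * r + mgfConst r + 1)

/-- The sum of the chaining increments. -/
noncomputable def dyadicSum (e : ℝ) : ℝ :=
  ∑' l : ℕ, ((l : ℝ) + 1) * (2 * (1 / 2) ^ l) ^ e

lemma dyadicSum_nonneg (e : ℝ) : 0 ≤ dyadicSum e :=
  tsum_nonneg fun l => by positivity

lemma mgfConst_nonneg (r : ℕ) : 0 ≤ mgfConst r := by unfold mgfConst; positivity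

lemma chainConst_nonneg (r : ℕ) : 0 ≤ chainConst r := by
  have := mgfConst_nonneg r
  unfold chainConst; positivity

/-- The constant `C_r` of the deviation bound. -/
noncomputable def deviationConst (r : ℕ) : ℝ :=
  chainConst r * (dyadicSum 1 + dyadicSum (2 / (r : ℝ))) + 1

lemma deviationConst_pos (r : ℕ) : 0 < deviationConst r := by
  have := mul_nonneg (chainConst_nonneg r)
    (add_nonneg (dyadicSum_nonneg 1) (dyadicSum_nonneg (2 / (r : ℝ))))
  unfold deviationConst; linarith

/-- The level-`l` chaining increment. -/
noncomputable def chainStep (r d n : ℕ) (K γ : ℝ) (l : ℕ) : ℝ :=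
  chainConst r * (((l : ℝ) + 1) * (d + γ)) / n *
    (2 * (1 / 2) ^ l * √(n / d) + (2 * (1 / 2) ^ l) ^ (2 / (r : ℝ)) * K)

section chainStep

variable {r d n : ℕ} {K γ : ℝ}

lemma hasSum_chainStep (hr : 1 ≤ r) : HasSum (chainStep r d n K γ)
    (chainConst r * (d + γ) / n * √(n / d) * dyadicSum 1
      + chainConst r * (d + γ) / n * K * dyadicSum (2 / (r : ℝ))) := by
  have hr0 : (0 : ℝ) < r := by exact_mod_cast hr
  have h1 := (summable_succ_mul_dyadic_rpow one_pos).hasSum.mul_left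
    (chainConst r * (d + γ) / n * √(n / d))
  have h2 := (summable_succ_mul_dyadic_rpow (e := 2 / (r : ℝ)) (by positivity)).hasSum.mul_left
    (chainConst r * (d + γ) / n * K)
  refine (h1.add h2).congr_fun fun l => ?_
  rw [chainStep, Real.rpow_one]
  ring

lemma tsum_chainStep_lt (hr : 1 ≤ r) (hd : 1 ≤ d) (hn : 1 ≤ n) (hK : 0 ≤ K) (hγ : 0 < γ) :
    ∑' l, chainStep r d n K γ l
      < deviationConst r * (d + γ) * (1 / √((d : ℝ) * n) + K / n) := by
  have hn0 : (0 : ℝ) < n := by exact_mod_cast hn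
  have hd0 : (0 : ℝ) < d := by exact_mod_cast hd
  have hC := chainConst_nonneg r
  have hS1 := dyadicSum_nonneg 1
  have hS2 := dyadicSum_nonneg (2 / (r : ℝ))
  have hroot : √((n : ℝ) / d) / n = 1 / √((d : ℝ) * n) := by
    rw [Real.sqrt_div hn0.le, Real.sqrt_mul hd0.le, div_div, div_eq_div_iff (by positivity)
      (by positivity)]
    linear_combination √(d : ℝ) * Real.mul_self_sqrt hn0.le
  rw [(hasSum_chainStep hr).tsum_eq]
  set u : ℝ := 1 / √((d : ℝ) * n) with hu
  have hu0 : 0 < u := by positivity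
  have hw0 : 0 ≤ K / n := by positivity
  set S := dyadicSum 1
  set S' := dyadicSum (2 / (r : ℝ))
  calc _ = chainConst r * (d + γ) * (√((n : ℝ) / d) / n * S + K / n * S') := by ring
    _ = chainConst r * (d + γ) * (u * S + K / n * S') := by rw [hroot]
    _ ≤ chainConst r * (d + γ) * ((u + K / n) * (S + S')) := by
        gcongr
        nlinarith [mul_nonneg hu0.le hS2, mul_nonneg hw0 hS1]
    -- The `+ 1` in `deviationConst` makes this strict, as needed to exclude equality in the event
    -- with `≤`.
    _ < chainConst r * (d + γ) * ((u + K / n) * (S + S')) + (d + γ) * (u + K / n) := by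
        have : 0 < (d + γ) * (u + K / n) := by positivity
        linarith
    _ = _ := by rw [deviationConst]; ring

/-- In `chainConst`, the term `4 r` pays for the number of pairs (as `5 ≤ exp 2`), `mgfConst r` for
the moment generating function, and `1` leaves `exp(-γ - (l+1))` because `d ≥ 1`. -/
lemma card_mul_exp_le (hr : 1 ≤ r) (hd : 1 ≤ d) (hγ : 0 < γ) {m l : ℕ}
    (hm : m ≤ 5 ^ (2 * r * d * (l + 1))) :
    m * Real.exp (mgfConst r * d - chainConst r * (((l : ℝ) + 1) * (d + γ)) / (48 * r ^ 2))
      ≤ Real.exp (-γ) * (1 / 2) ^ (l + 1) := by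
  have hr0 : (0 : ℝ) < r := by exact_mod_cast hr
  have hd1 : (1 : ℝ) ≤ d := by exact_mod_cast hd
  have hM := mgfConst_nonneg r
  have h5 : (5 : ℝ) ≤ Real.exp 2 := by
    have := Real.quadratic_le_exp_of_nonneg (x := 2) (by norm_num)
    linarith
  have h2 : Real.exp (-1) ≤ 1 / 2 := by
    rw [Real.exp_neg, one_div]
    gcongr
    linarith [Real.add_one_le_exp 1]
  have hm' : (m : ℝ) ≤ Real.exp (4 * r * d * (l + 1)) := by
    calc (m : ℝ) ≤ 5 ^ (2 * r * d * (l + 1)) := by exact_mod_cast hm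
      _ ≤ Real.exp 2 ^ (2 * r * d * (l + 1)) := by gcongr
      _ = _ := by rw [← Real.exp_nat_mul]; push_cast; ring_nf
  have hdiv : chainConst r * (((l : ℝ) + 1) * (d + γ)) / (48 * r ^ 2)
      = (4 * r + mgfConst r + 1) * ((l + 1) * (d + γ)) := by
    rw [chainConst]; field_simp
  rw [hdiv]
  calc _ ≤ Real.exp (4 * r * d * (l + 1)) * Real.exp (mgfConst r * d
          - (4 * r + mgfConst r + 1) * ((l + 1) * (d + γ))) := by gcongr
    _ ≤ Real.exp (-γ) * Real.exp (-1) ^ (l + 1) := by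
        rw [← Real.exp_nat_mul, ← Real.exp_add, ← Real.exp_add]
        refine Real.exp_le_exp.2 ?_
        have hl : (0 : ℝ) ≤ l := l.cast_nonneg
        have e1 : 0 ≤ mgfConst r * (d * l + l * γ + γ) := by positivity
        have e2 : 0 ≤ 4 * r * ((l + 1) * γ) := by positivity
        have e3 : 0 ≤ ((l : ℝ) + 1) * (d - 1) := mul_nonneg (by positivity) (by linarith)
        have e4 : 0 ≤ l * γ := by positivity
        push_cast
        linarith
    _ ≤ _ := by gcongr

end chainStep

/-! ### Chaining over the nets and removal of the normalisation -/

section main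

variable {r d n : ℕ} {φ : Fin r → ℝ → ℝ} {Ω : Type*} [MeasurableSpace Ω] {P : Measure Ω}
  [IsProbabilityMeasure P] {a : Ω → EuclideanSpace ℝ (Fin d)}
  {A : Fin n → Ω → EuclideanSpace ℝ (Fin d)} {B : Fin r → ℝ}

lemma supDeviation_tail_of_unit (hr : 1 ≤ r) (hd : 1 ≤ d) (hn : 1 ≤ n) (ha : Measurable a)
    (hA : ∀ i, Measurable (A i)) (hind : iIndepFun A P) (hid : ∀ i, IdentDistrib (A i) a P P)
    (hsub : IsSubGaussianVector P 1 a)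
    (hφ0 : ∀ k, φ k 0 = 0) (hφ : ∀ k, LipschitzWith 1 (φ k))
    (hB : ∀ k, ∀ᵐ ω ∂P, ∀ x ∈ Metric.closedBall (0 : EuclideanSpace ℝ (Fin d)) 1,
      |φ k (inner ℝ (a ω) x)| ≤ B k) {K : ℝ} (hK0 : 0 ≤ K)
    (hK : r = 1 ∨ (2 ≤ r ∧ K = (∏ k, B k) ^ (1 - 2 / (r : ℝ)))) {γ : ℝ} (hγ : 0 < γ) :
    P.real {ω | deviationConst r * (d + γ) * (1 / √((d : ℝ) * n) + K / n)
      ≤ supDeviation P φ a A ω} ≤ Real.exp (-γ) := by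
  classical
  obtain ⟨N, hN0, hN⟩ := exists_dyadic_nets d
  let δ : ℕ → ℝ := fun l => 2 * (1 / 2) ^ l
  let T : ℕ → Finset ((Fin r → EuclideanSpace ℝ (Fin d)) × (Fin r → EuclideanSpace ℝ (Fin d))) :=
    fun l => (Fintype.piFinset (fun _ => N (l + 1)) ×ˢ Fintype.piFinset (fun _ => N l)).filter
      fun p => ∀ k, ‖p.1 k - p.2 k‖ ≤ δ l
  let bad : ℕ → Set Ω := fun l => ⋃ p ∈ T l, {ω | chainStep r d n K γ l
    ≤ deviation P φ a A p.1 ω - deviation P φ a A p.2 ω}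
  have hNball : ∀ l, ∀ z ∈ N l, ‖z‖ ≤ 1 := fun l z hz => mem_closedBall_zero_iff.1 ((hN l).1 hz)
  have hTcard : ∀ l, (T l).card ≤ 5 ^ (2 * r * d * (l + 1)) := fun l => by
    refine (Finset.card_filter_le _ _).trans ?_
    rw [Finset.card_product, Fintype.card_piFinset_const, Fintype.card_piFinset_const]
    calc _ ≤ (5 ^ (d * (l + 1))) ^ r * (5 ^ (d * l)) ^ r := by
          gcongr
          · exact (hN (l + 1)).2.1
          · exact (hN l).2.1
      _ = 5 ^ (d * (l + 1) * r + d * l * r) := by rw [← pow_mul, ← pow_mul, pow_add]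
      _ ≤ _ := Nat.pow_le_pow_right (by norm_num) (by nlinarith [Nat.zero_le (d * r)])
  have hbad : ∀ l, P.real (bad l) ≤ Real.exp (-γ) * (1 / 2) ^ (l + 1) := fun l => by
    refine le_trans ?_ (card_mul_exp_le hr hd hγ (hTcard l))
    refine (measureReal_biUnion_finset_le _ _).trans ?_
    rw [← nsmul_eq_mul]
    refine Finset.sum_le_card_nsmul _ _ _ fun p hp => ?_
    obtain ⟨hp1, hp2⟩ := Finset.mem_filter.1 hp
    obtain ⟨hp3, hp4⟩ := Finset.mem_product.1 hp1
    exact deviation_increment_tail hr hd hn ha hA hind hid hsub hφ0 hφ hB hK0 hK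
      (by positivity) (fun k => hNball _ _ (Fintype.mem_piFinset.1 hp3 k))
      (fun k => hNball _ _ (Fintype.mem_piFinset.1 hp4 k)) hp2 _
  have hunion : P.real (⋃ l, bad l) ≤ Real.exp (-γ) := by
    refine ENNReal.toReal_le_of_le_ofReal (Real.exp_pos _).le ?_
    have hgeo : HasSum (fun l : ℕ => Real.exp (-γ) * (1 / 2) ^ (l + 1)) (Real.exp (-γ)) := by
      have := (hasSum_geometric_two' 1).mul_left (Real.exp (-γ))
      rw [mul_one] at this
      refine this.congr_fun fun l => ?_
      rw [pow_succ, one_div_pow]; ring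
    calc P (⋃ l, bad l) ≤ ∑' l, P (bad l) := measure_iUnion_le _
      _ ≤ ∑' l : ℕ, ENNReal.ofReal (Real.exp (-γ) * (1 / 2) ^ (l + 1)) := by
          refine ENNReal.tsum_le_tsum fun l => ?_
          rw [← ofReal_measureReal (measure_ne_top P _)]
          exact ENNReal.ofReal_le_ofReal (hbad l)
      _ = ENNReal.ofReal (Real.exp (-γ)) := by
          rw [← ENNReal.ofReal_tsum_of_nonneg (fun l => by positivity) hgeo.summable, hgeo.tsum_eq]
  -- Only monotonicity of the measure is used, so the supremum need not be measurable.
  refine (measureReal_mono fun ω hω => ?_).trans hunion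
  by_contra hgood
  refine absurd (show _ ≤ supDeviation P φ a A ω from hω) (not_le.2 ?_)
  have : Nonempty (Metric.closedBall (0 : EuclideanSpace ℝ (Fin d)) 1) := ⟨⟨0, by simp⟩⟩
  refine lt_of_le_of_lt ?_ (tsum_chainStep_lt hr hd hn hK0 hγ)
  refine ciSup_le fun x => ?_
  choose π hπN hπx using fun (l : ℕ) (k : Fin r) => (hN l).2.2 (x k) (x k).2
  let p : ℕ → Fin r → Metric.closedBall (0 : EuclideanSpace ℝ (Fin d)) 1 :=
    fun l k => ⟨π l k, (hN l).1 (hπN l k)⟩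
  refine le_tsum_of_chaining (continuous_deviation (A := A) ha hφ hB ω) (x := x) (p := p) ?_
    (hasSum_chainStep hr).summable (fun l => ?_) ?_ fun l => ?_
  · refine tendsto_pi_nhds.2 fun k => tendsto_iff_dist_tendsto_zero.2 ?_
    refine squeeze_zero (fun _ => dist_nonneg) (fun l => ?_)
      (tendsto_pow_atTop_nhds_zero_of_lt_one (r := (1 / 2 : ℝ)) (by norm_num) (by norm_num))
    rw [Subtype.dist_eq, dist_comm, dist_eq_norm]
    exact hπx l k
  · have := chainConst_nonneg r
    unfold chainStep
    positivity
  · have h0 : ∀ v, ridgeProd φ (fun k => (p 0 k : EuclideanSpace ℝ (Fin d))) v = 0 := fun v => by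
      refine Finset.prod_eq_zero (Finset.mem_univ ⟨0, hr⟩) ?_
      have : π 0 ⟨0, hr⟩ = 0 := by simpa [hN0] using hπN 0 ⟨0, hr⟩
      simp [p, this, hφ0]
    simp [deviation, h0]
  · refine le_of_lt (not_le.1 fun hcon => hgood ?_)
    refine Set.mem_iUnion.2 ⟨l, Set.mem_iUnion₂.2 ⟨⟨π (l + 1), π l⟩, ?_, hcon⟩⟩
    refine Finset.mem_filter.2 ⟨Finset.mem_product.2 ⟨Fintype.mem_piFinset.2 (hπN (l + 1)),
      Fintype.mem_piFinset.2 (hπN l)⟩, fun k => ?_⟩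
    calc ‖π (l + 1) k - π l k‖ ≤ ‖π (l + 1) k - x k‖ + ‖(x k : EuclideanSpace ℝ (Fin d)) - π l k‖ :=
          norm_sub_le_norm_sub_add_norm_sub _ _ _
      _ ≤ (1 / 2) ^ (l + 1) + (1 / 2) ^ l := by
          gcongr
          · rw [norm_sub_rev]; exact hπx (l + 1) k
          · exact hπx l k
      _ ≤ δ l := by
          have : (0 : ℝ) < (1 / 2) ^ l := by positivity
          simp only [δ, pow_succ]; linarith

end main

theorem mainTheorem6 (r : ℕ) (hr : 1 ≤ r) :
    ∃ C : ℝ, 0 < C ∧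
      ∀ (d n : ℕ), 1 ≤ d → 1 ≤ n →
      ∀ (Ω : Type*) [MeasurableSpace Ω] (P : Measure Ω) [IsProbabilityMeasure P]
        (a : Ω → EuclideanSpace ℝ (Fin d)) (A : Fin n → Ω → EuclideanSpace ℝ (Fin d)),
        Measurable a → (∀ i, Measurable (A i)) →
        iIndepFun A P → (∀ i, IdentDistrib (A i) a P P) →
      ∀ ρ : ℝ, 0 < ρ → IsSubGaussianVector P ρ a →
      ∀ (φ : Fin r → ℝ → ℝ) (B : Fin r → ℝ),
        (∀ k, φ k 0 = 0) → (∀ k, LipschitzWith 1 (φ k)) →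
        (∀ k, ∀ᵐ ω ∂P, ∀ x ∈ Metric.closedBall (0 : EuclideanSpace ℝ (Fin d)) 1,
          |φ k (inner ℝ (a ω) x)| ≤ B k) →
      ∀ γ : ℝ, 0 < γ →
        P.real {ω | ρ ^ r * C * (d + γ) *
              (1 / √((d : ℝ) * n) + ((∏ k, B k) / ρ ^ r) ^ (1 - 2 / (r : ℝ)) / n)
            ≤ supDeviation P φ a A ω}
          ≤ r * (Real.pi ^ 2 / 6) * Real.exp (-γ) := by
  refine ⟨deviationConst r, deviationConst_pos r, ?_⟩
  intro d n hd hn Ω _ P _ a A ha hA hind hid ρ hρ hsub φ B hφ0 hφ hB γ hγ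
  -- This rescaling makes the parameter 1, keeps each `φ k` 1-Lipschitz and multiplies every product
  -- by `ρ ^ (-r)`.
  let a' : Ω → EuclideanSpace ℝ (Fin d) := fun ω => ρ⁻¹ • a ω
  let A' : Fin n → Ω → EuclideanSpace ℝ (Fin d) := fun i ω => ρ⁻¹ • A i ω
  let φ' : Fin r → ℝ → ℝ := fun k t => ρ⁻¹ * φ k (ρ * t)
  let B' : Fin r → ℝ := fun k => ρ⁻¹ * B k
  have hsmul : Measurable fun v : EuclideanSpace ℝ (Fin d) => ρ⁻¹ • v := measurable_const_smul _
  have hval : ∀ k (v x : EuclideanSpace ℝ (Fin d)),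
      φ' k (inner ℝ (ρ⁻¹ • v) x) = ρ⁻¹ * φ k (inner ℝ v x) := fun k v x => by
    simp only [φ', real_inner_smul_left]
    rw [mul_inv_cancel_left₀ hρ.ne']
  have hsub' : IsSubGaussianVector P 1 a' := fun ε hε x hx => by
    refine le_trans (le_of_eq ?_) (hsub ε hε x hx)
    congr 1
    ext ω
    simp only [a', Set.mem_ofPred_eq, real_inner_smul_left, abs_mul, abs_inv, abs_of_pos hρ, one_mul]
    exact le_inv_mul_iff₀ hρ
  have hφ' : ∀ k, LipschitzWith 1 (φ' k) := fun k => by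
    refine LipschitzWith.of_dist_le_mul fun s t => ?_
    have h := (hφ k).dist_le_mul (ρ * s) (ρ * t)
    simp only [Real.dist_eq, NNReal.coe_one, one_mul, φ', ← mul_sub, abs_mul, abs_inv,
      abs_of_pos hρ] at h ⊢
    rwa [inv_mul_le_iff₀ hρ]
  have hB' : ∀ k, ∀ᵐ ω ∂P, ∀ x ∈ Metric.closedBall (0 : EuclideanSpace ℝ (Fin d)) 1,
      |φ' k (inner ℝ (a' ω) x)| ≤ B' k := fun k => by
    filter_upwards [hB k] with ω hω x hx
    rw [hval, abs_mul, abs_inv, abs_of_pos hρ]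
    exact mul_le_mul_of_nonneg_left (hω x hx) (by positivity)
  have hprodB : ∏ k, B' k = (∏ k, B k) / ρ ^ r := by
    simp only [B', Finset.prod_mul_distrib, Finset.prod_const, Finset.card_univ, Fintype.card_fin]
    rw [inv_pow, div_eq_inv_mul]
  have hBn : 0 ≤ (∏ k, B k) / ρ ^ r := by
    rw [← hprodB]
    exact Finset.prod_nonneg fun k _ =>
      bound_nonneg (φ := φ') (a := a') (P := P) (fun k => by simp [φ', hφ0]) hB' k
  have hsup : ∀ ω, supDeviation P φ' a' A' ω = (ρ ^ r)⁻¹ * supDeviation P φ a A ω := fun ω => by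
    rw [supDeviation, supDeviation, Real.mul_iSup_of_nonneg (by positivity)]
    refine iSup_congr fun x => ?_
    simp only [a', A', hval, Finset.prod_mul_distrib, Finset.prod_const, Finset.card_univ,
      Fintype.card_fin, integral_const_mul, ← mul_sub, ← Finset.mul_sum, inv_pow]
    ring
  have key := supDeviation_tail_of_unit (φ := φ') (B := B') (a := a') (A := A') (P := P) hr hd hn
    (hsmul.comp ha) (fun i => hsmul.comp (hA i)) (hind.comp (fun _ v => ρ⁻¹ • v) fun _ => hsmul)
    (fun i => (hid i).comp hsmul) hsub' (fun k => by simp [φ', hφ0]) hφ' hB'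
    -- For r = 1 the exponent is `-1` and only `K ≥ 0` matters; the default value `0 ^ (-1) = 0`
    -- agrees with the stated convention.
    (K := ((∏ k, B k) / ρ ^ r) ^ (1 - 2 / (r : ℝ))) (Real.rpow_nonneg hBn _)
    (by rw [hprodB]; exact hr.eq_or_lt.imp Eq.symm fun h => ⟨h, rfl⟩) hγ
  have hpi : 1 ≤ r * (Real.pi ^ 2 / 6) := by
    have : (1 : ℝ) ≤ r := by exact_mod_cast hr
    nlinarith [Real.pi_gt_three]
  calc _ = P.real {ω | deviationConst r * (d + γ) *
        (1 / √((d : ℝ) * n) + ((∏ k, B k) / ρ ^ r) ^ (1 - 2 / (r : ℝ)) / n)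
          ≤ supDeviation P φ' a' A' ω} := by
        congr 1
        ext ω
        rw [Set.mem_ofPred_eq, Set.mem_ofPred_eq, hsup, le_inv_mul_iff₀ (by positivity)]
        ring_nf
    _ ≤ Real.exp (-γ) := key
    _ ≤ _ := le_mul_of_one_le_left (Real.exp_pos _).le hpi
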